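/- Let $\mathcal X,\mathcal Y$ be standard Borel spaces and $n\in\mathbb N$. Let $\mathbf X_n=(X_i)_{i\in[n]}$ and $\overline{\mathbf X}=(\overline X_{i,j})_{i,j\in[n]}$ be random vertex and edge features in $\mathcal X$, and $\mathbf Y_n=(Y_i)_{i\in[n]}$, $\overline{\mathbf Y}=(\overline Y_{i,j})_{i,j\in[n]}$ random vertex and edge features in $\mathcal Y$, with $\overline{\mathbf X}$ and $\overline{\mathbf Y}$ symmetric, all defined on a probability space that also carries a uniform $[0,1]$ random variable independent of $(\mathbf X_n,\overline{\mathbf X},\mathbf Y_n,\overline{\mathbf Y})$. A permutation $\pi\in\mathbb S_n$ acts by $\pi\cdot(\mathbf x,\overline{\mathbf x})=((x_{\pi(i)})_i,(\overline x_{\pi(i),\pi(j)})_{i,j})$. Assume that $(\mathbf X_n,\overline{\mathbf X})$ is jointly exchangeable, i.e. $\pi\cdot(\mathbf X_n,\overline{\mathbf X})\overset{d}{=}(\mathbf X_n,\overline{\mathbf X})$ for all $\pi\in\mathbb S_n$; that $(\overline Y_{i,j})_{j\le i}$ are mutually conditionally independent given $(\mathbf X_n,\overline{\mathbf X})$; and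 that for each $i$, $Y_i$ and $(Y_k)_{k\ne i}$ are conditionally independent given $(\mathbf X_n,\overline{\mathbf X},\overline{\mathbf Y})$. For vertex features $\mathbf x$, symmetric edge features $\overline{\mathbf a}$ (in any standard Borel space) and $i,j\in[n]$, consider the broadcast array augmented with the rows and columns of $i$ and $j$, whose entries are $$\big(\overline a_{k,\ell},\{x_k,x_\ell\},\{(\overline a_{i,\ell},\overline a_{j,\ell}),(\overline a_{k,i},\overline a_{k,j})\}\big),\qquad k,\ell\in[n],$$ together with its set $\{i,j\}$ of fixed vertices. The augmented canonical form $\mathbf C^{\{i,j\}}_{\mathbf B(\mathbf x,\overline{\mathbf a})}$ is the image of this array with fixed vertices under a canonicalization, i.e. under a measurable map that selects one representative from each orbit of arrays with fixed vertices under simultaneous relabelling (of rows, columns and fixed vertices) by $\mathbb S_n$; write $\mathbf C^{\{i\}}$ for $\mathbf C^{\{i,i\}}$. Let $\mathbf S(\overline{\mathbf X},\overline{\mathbf Y})$ be the stacked array with entries $(\overline X_{i,j},\overline Y_{i,j})$. Then, for any choice of canonicalizations, $(\mathbf Y_n,\overline{\mathbf Y})$ is conditionally $\mathbb S_n$-equivariant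 given $(\mathbf X_n,\overline{\mathbf X})$, i.e. $$P\big((\mathbf Y_n,\overline{\mathbf Y})\in A\mid(\mathbf X_n,\overline{\mathbf X})\in B\big)=P\big(\pi\cdot(\mathbf Y_n,\overline{\mathbf Y})\in A\mid\pi\cdot(\mathbf X_n,\overline{\mathbf X})\in B\big)$$ for all $\pi\in\mathbb S_n$ and all measurable $A,B$ (both sides being read as $0$ when the conditioning events are null), if and only if there are measurable $\mathcal Y$-valued functions $f_e,f_v$ such that $$\overline Y_{i,j}\overset{a.s.}{=}f_e\big(\eta_{i,j},\overline X_{i,j},\{X_i,X_j\},\mathbf C^{\{i,j\}}_{\mathbf B(\mathbf X_n,\overline{\mathbf X})}\big),\quad i,j\in[n],$$ $$Y_i\overset{a.s.}{=}f_v\big(\eta_i,X_i,\overline X_{i,i},\overline Y_{i,i},\mathbf C^{\{i\}}_{\mathbf B(\mathbf X_n,\mathbf S(\overline{\mathbf X},\overline{\mathbf Y}))}\big),\quad i\in[n],$$ for i.i.d. uniform $[0,1]$ random variables $(\eta_{i,j})_{j\le i}$ independent of $(\mathbf X_n,\overline{\mathbf X})$, with $\eta_{i,j}=\eta_{j,i}$,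 and i.i.d. uniform $[0,1]$ random variables $(\eta_i)_{i\in[n]}$ independent of $(\mathbf X_n,\overline{\mathbf X},\overline{\mathbf Y})$. -/

import Mathlib

open MeasureTheory ProbabilityTheory
open scoped unitInterval

/-- Joint relabelling of the vertices of an array: `[π · A]_{k,l} = A_{π(k),π(l)}`. -/
def relabelArray {n : ℕ} {E : Type*} (π : Equiv.Perm (Fin n)) (A : Fin n → Fin n → E) :
    Fin n → Fin n → E :=
  fun k l => A (π k) (π l)

/-- A vertex feature-augmented array: a sequence of `V`-valued vertex features together with an
`E`-valued array of edge features. -/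
abbrev FeatureGraph (n : ℕ) (V E : Type*) := (Fin n → V) × (Fin n → Fin n → E)

/-- The simultaneous action of a permutation on the vertex features and on the array. -/
def FeatureGraph.relabel {n : ℕ} {V E : Type*} (π : Equiv.Perm (Fin n))
    (G : FeatureGraph n V E) : FeatureGraph n V E :=
  (fun i => G.1 (π i), relabelArray π G.2)

/-- Joint exchangeability of a random feature-augmented array:
its law is invariant under simultaneous relabelling. -/
def JointlyExchangeable {Ω V E : Type*} [MeasurableSpace Ω] [MeasurableSpace V] [MeasurableSpace E]
    {n : ℕ} (μ : Measure Ω) (G : Ω → FeatureGraph n V E) : Prop :=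
  ∀ π : Equiv.Perm (Fin n), IdentDistrib (fun ω => (G ω).relabel π) G μ μ

/-- `H` is conditionally `S_n`-equivariant given `G`:
`P(H ∈ A ∣ G ∈ B) = P(π · H ∈ A ∣ π · G ∈ B)` for all `π` and all measurable `A`, `B`. -/
def CondEquivariant {Ω V E V' E' : Type*} [MeasurableSpace Ω]
    [MeasurableSpace V] [MeasurableSpace E] [MeasurableSpace V'] [MeasurableSpace E']
    {n : ℕ} (μ : Measure Ω) (G : Ω → FeatureGraph n V E) (H : Ω → FeatureGraph n V' E') : Prop :=
  ∀ (π : Equiv.Perm (Fin n)) (A : Set (FeatureGraph n V' E')) (B : Set (FeatureGraph n V E)),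
    MeasurableSet A → MeasurableSet B →
      ProbabilityTheory.cond μ {ω | G ω ∈ B} {ω | H ω ∈ A} =
        ProbabilityTheory.cond μ {ω | (G ω).relabel π ∈ B} {ω | (H ω).relabel π ∈ A}

/-- `U` and `V` are conditionally independent given `σ(Z)` (on an arbitrary probability space,
which need not be standard Borel). -/
def CondIndepGiven {Ω α β γ : Type*} [MeasurableSpace Ω] [MeasurableSpace α] [MeasurableSpace β]
    [MeasurableSpace γ] (μ : Measure Ω) (Z : Ω → γ) (U : Ω → α) (V : Ω → β) : Prop :=
  ∀ (A : Set α) (B : Set β), MeasurableSet A → MeasurableSet B →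
    μ⟦U ⁻¹' A ∩ V ⁻¹' B | MeasurableSpace.comap Z inferInstance⟧ =ᵐ[μ]
      μ⟦U ⁻¹' A | MeasurableSpace.comap Z inferInstance⟧ *
        μ⟦V ⁻¹' B | MeasurableSpace.comap Z inferInstance⟧

/-- The family `(V i)` is mutually conditionally independent given `σ(Z)`. -/
def MutuallyCondIndepGiven {Ω ι β γ : Type*} [MeasurableSpace Ω] [MeasurableSpace β]
    [MeasurableSpace γ] (μ : Measure Ω) (Z : Ω → γ) (V : ι → Ω → β) : Prop :=
  ∀ (s : Finset ι) (A : ι → Set β), (∀ i ∈ s, MeasurableSet (A i)) →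
    μ⟦⋂ i ∈ s, V i ⁻¹' A i | MeasurableSpace.comap Z inferInstance⟧ =ᵐ[μ]
      ∏ i ∈ s, μ⟦V i ⁻¹' A i | MeasurableSpace.comap Z inferInstance⟧

/-- The positions `(i, j)` with `j ≤ i`, one for each entry of a symmetric array. -/
abbrev LowerIdx (n : ℕ) := {p : Fin n × Fin n // p.2 ≤ p.1}

/-- A family of `[0,1]`-valued random variables that are i.i.d. uniform. -/
structure IIDUniform {Ω ι : Type*} [MeasurableSpace Ω] (μ : Measure Ω) (η : ι → Ω → I) :
    Prop where
  measurable : ∀ i, Measurable (η i)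
  law : ∀ i, μ.map (η i) = volume
  indep : iIndepFun η μ

/-- Entries of an augmented broadcast array: the edge feature at `(k, l)`, the unordered pair of
the features of `k` and `l`, and an unordered pair of paired edge features. Curly braces of the
mathematical notation are elements of `Sym2`, with the quotient `σ`-algebra. -/
abbrev AugEntry (V E : Type*) := E × Sym2 V × Sym2 (E × E)

/-- An array on `[n] × [n]` together with the set of vertices that are held fixed. -/
abbrev MarkedArray (n : ℕ) (D : Type*) := (Fin n → Fin n → D) × Set (Fin n)

/-- Relabelling of an array together with its set of fixed vertices: vertex `k` of the relabelled
object is vertex `π k` of the original one. -/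
def MarkedArray.relabel {n : ℕ} {D : Type*} (π : Equiv.Perm (Fin n)) (M : MarkedArray n D) :
    MarkedArray n D :=
  (relabelArray π M.1, π ⁻¹' M.2)

/-- The broadcast array `B(x, a)` augmented with the rows and columns of `i` and `j`; its
`(k, l)` entry is `(a_{kl}, {x_k, x_l}, {(a_{il}, a_{jl}), (a_{ki}, a_{kj})})`.
The fixed vertices are `i` and `j`. -/
def augmentedArray {n : ℕ} {V E : Type*} (i j : Fin n) (G : FeatureGraph n V E) :
    MarkedArray n (AugEntry V E) :=
  (fun k l => (G.2 k l, s(G.1 k, G.1 l), s((G.2 i l, G.2 j l), (G.2 k i, G.2 k j))), {i, j})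

/-- A (measurable) canonicalization procedure: it picks one representative of every orbit of
arrays with fixed vertices, under relabelling. -/
structure Canonicalization (n : ℕ) (D : Type*) [MeasurableSpace D] where
  /-- The canonical form. -/
  canon : MarkedArray n D → MarkedArray n D
  measurable_canon : Measurable canon
  canon_mem_orbit : ∀ M, ∃ π : Equiv.Perm (Fin n), canon M = M.relabel π
  canon_relabel : ∀ (π : Equiv.Perm (Fin n)) (M), canon (M.relabel π) = canon M

/-- The augmented canonical form `C^{{i,j}}_{B(x,a)}`. -/
def augmentedCanonicalForm {n : ℕ} {V E : Type*} [MeasurableSpace V] [MeasurableSpace E]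
    (C : Canonicalization n (AugEntry V E)) (i j : Fin n) (G : FeatureGraph n V E) :
    MarkedArray n (AugEntry V E) :=
  C.canon (augmentedArray i j G)

/-- The stacked array `S(a, b)` with entries `(a_{kl}, b_{kl})`. -/
def stack {n : ℕ} {E E' : Type*} (a : Fin n → Fin n → E) (b : Fin n → Fin n → E') :
    Fin n → Fin n → E × E' :=
  fun k l => (a k l, b k l)

/-- Encoding of a two-element set by its smaller and larger element. -/
theorem exists_inj_sym2 {V : Type*} [MeasurableSpace V] (h : ∃ φ : V → ℝ, Measurable φ ∧ Function.Injective φ) :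
    ∃ φ : Sym2 V → ℝ × ℝ, Measurable φ ∧ Function.Injective φ := by
  obtain ⟨φ, hm, hi⟩ := h
  refine ⟨fun p => Quot.lift (fun q : V × V => (min (φ q.1) (φ q.2), max (φ q.1) (φ q.2))) ?_ p, ?_, ?_⟩
  · rintro ⟨a, b⟩ ⟨c, d⟩ h
    cases h
    · rfl
    · simp [min_comm, max_comm]
  · refine (measurable_from_quotient (s := Sym2.Rel.setoid V)).2 ?_
    show Measurable (fun q : V × V => (min (φ q.1) (φ q.2), max (φ q.1) (φ q.2)))
    fun_prop
  · intro p q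
    induction p with | _ a b
    induction q with | _ c d
    intro h
    have h' : (min (φ a) (φ b), max (φ a) (φ b)) = (min (φ c) (φ d), max (φ c) (φ d)) := h
    have e1 := congrArg Prod.fst h'
    have e2 := congrArg Prod.snd h'
    simp only at e1 e2
    have key : (φ a = φ c ∧ φ b = φ d) ∨ (φ a = φ d ∧ φ b = φ c) := by
      rcases le_total (φ a) (φ b) with u | u <;> rcases le_total (φ c) (φ d) with v | v <;> simp_all
    rw [Sym2.eq_iff]
    rcases key with ⟨x, y⟩ | ⟨x, y⟩
    · exact Or.inl ⟨hi x, hi y⟩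
    · exact Or.inr ⟨hi x, hi y⟩

/-- A standard Borel space has a measurable injection into the reals. -/
theorem exists_inj_real (V : Type*) [MeasurableSpace V] [StandardBorelSpace V] :
    ∃ φ : V → ℝ, Measurable φ ∧ Function.Injective φ :=
  ⟨_, (measurableEmbedding_embeddingReal V).measurable, (measurableEmbedding_embeddingReal V).injective⟩

/-- Canonicalization procedures exist: choose the smallest member of each orbit, in the order
induced by a measurable injection into the reals. -/
theorem Canonicalization.nonempty_of_injective {n : ℕ} {D B : Type*} [MeasurableSpace D] [MeasurableSpace B] [StandardBorelSpace B]
    (ψ : D → B) (hψ : Measurable ψ) (hψi : Function.Injective ψ) : Nonempty (Canonicalization n D) := by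
  obtain ⟨χ, hχ, hχi⟩ := exists_inj_real ((Fin n → Fin n → B) × (Fin n → Prop))
  let φ : MarkedArray n D → ℝ := fun M => χ (fun k l => ψ (M.1 k l), fun k => k ∈ M.2)
  have hrel : ∀ π : Equiv.Perm (Fin n), Measurable (MarkedArray.relabel (D := D) π) := by
    intro π
    refine Measurable.prodMk ?_ ?_
    · show Measurable fun M : MarkedArray n D => fun k l => M.1 (π k) (π l)
      fun_prop
    · refine measurable_pi_iff.2 fun k => ?_
      exact (measurable_pi_iff.1 (measurable_snd : Measurable fun M : MarkedArray n D => M.2)) (π k)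
  have hφ : Measurable φ := by
    refine hχ.comp (Measurable.prodMk (by fun_prop) ?_)
    exact (measurable_snd : Measurable fun M : MarkedArray n D => M.2)
  have hφi : Function.Injective φ := by
    intro M N h
    have h := hχi h
    refine Prod.ext ?_ ?_
    · funext k l
      exact hψi (congrFun (congrFun (congrArg Prod.fst h) k) l)
    · exact Set.ext fun k => iff_of_eq (congrFun (congrArg Prod.snd h) k)
  have hne : (Finset.univ : Finset (Equiv.Perm (Fin n))).Nonempty := ⟨1, Finset.mem_univ _⟩
  let e := Fintype.equivFin (Equiv.Perm (Fin n))
  let P : MarkedArray n D → Equiv.Perm (Fin n) → Prop := fun M π => ∀ g, φ (M.relabel π) ≤ φ (M.relabel g)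
  have hP : ∀ π, MeasurableSet {M | P M π} := fun π => by
    simp only [P, Set.ofPred_forall]
    exact MeasurableSet.iInter fun g => measurableSet_le (hφ.comp (hrel π)) (hφ.comp (hrel g))
  have hex : ∀ M, ∃ π, P M π := fun M => by
    obtain ⟨π, -, h⟩ := Finset.exists_min_image Finset.univ (fun π => φ (M.relabel π)) hne
    exact ⟨π, fun g => h g (Finset.mem_univ _)⟩
  choose π hπ using hex
  have huniq : ∀ M g, P M g → M.relabel g = M.relabel (π M) := fun M g h =>
    hφi (le_antisymm (h _) (hπ M _))
  have hcomp : ∀ (g τ : Equiv.Perm (Fin n)) (M : MarkedArray n D),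
    (M.relabel g).relabel τ = M.relabel (g * τ) := fun g τ M => rfl
  refine ⟨⟨fun M => M.relabel (π M), ?_, fun M => ⟨_, rfl⟩, ?_⟩⟩
  · intro S hS
    have : (fun M => M.relabel (π M)) ⁻¹' S = ⋃ g, {M | P M g} ∩ (MarkedArray.relabel (D := D) g) ⁻¹' S := by
      ext M
      simp only [Set.mem_preimage, Set.mem_iUnion, Set.mem_inter_iff, Set.mem_ofPred_eq]
      constructor
      · exact fun h => ⟨π M, hπ M, h⟩
      · rintro ⟨g, h, h'⟩
        rwa [huniq M g h] at h'
    rw [this]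
    exact MeasurableSet.iUnion fun g => (hP g).inter (hrel g hS)
  · intro g M
    show (M.relabel g).relabel (π (M.relabel g)) = _
    rw [hcomp]
    apply huniq
    intro ρ
    have := hπ (M.relabel g) (g⁻¹ * ρ)
    rw [hcomp, hcomp] at this
    simpa using this

/-- Canonicalization procedures exist for the entries of augmented broadcast arrays. -/
theorem Canonicalization.nonempty_augEntry {n : ℕ} {V E : Type*} [MeasurableSpace V] [MeasurableSpace E] [StandardBorelSpace V] [StandardBorelSpace E] :
    Nonempty (Canonicalization n (AugEntry V E)) := by
  obtain ⟨a, ha, ha'⟩ := exists_inj_sym2 (exists_inj_real V)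
  obtain ⟨b, hb, hb'⟩ := exists_inj_sym2 (exists_inj_real (E × E))
  exact Canonicalization.nonempty_of_injective (fun d : AugEntry V E => (d.1, a d.2.1, b d.2.2)) (by fun_prop) (by
    rintro ⟨x, y, z⟩ ⟨x', y', z'⟩ h
    simp only [Prod.mk.injEq] at h ⊢
    exact ⟨h.1, ha' h.2.1, hb' h.2.2⟩)

/-! Since the input graph is exchangeable, conditional equivariance says exactly that the joint law
of input and output is invariant under relabelling (`condEquivariant_iff`). Conditioning events of
the two sides have the same mass, so the conditional probabilities have a common denominator.

Let the joint law be invariant. Then the conditional law of the entry at `(π i, π j)` given the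
graph `g` is a.e. that of the entry at `(i, j)` given `g.relabel π`
(`InvariantLaw.condDistrib_relabel`). For a symmetric array this law therefore depends only on the
orbit of `g` with the marked set `{i, j}`. The augmented canonical form determines that orbit: edge
features are a component of its entries, vertex features sit in the diagonal pairs `{x_k, x_k}`, and
the marks are carried along. So one measurable function of a uniform variable and the canonical form
generates all the conditional laws. Conditional independence allows the uniform variables to be
chosen i.i.d. and independent of the graph, with almost sure equality
(`MutuallyCondIndepGiven.exists_noise`). Vertex features are treated in the same way, with the
stacked array as the graph and the features placed on the diagonal of an array.

Conversely, the canonical form of `(i, j)` at a relabelled graph is that of `(π i, π j)` at the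
original one, and i.i.d. noise keeps its law under permutation. A representation of the stated form
thus yields an invariant joint law (`map_prodMk_eq_of_equivariant`), first for the edges and then
for the vertices over the stacked array. -/

/-! ### Noise outsourcing under conditional independence -/

/-- A coupling of the law of `Z` with a `T`-valued variable can be realised by a measurable
function of `Z` and of an independent uniform variable. -/
theorem exists_measurable_map_prodMk_eq {Ω S T : Type*} [MeasurableSpace Ω] [MeasurableSpace S]
    [MeasurableSpace T] [StandardBorelSpace T] [Nonempty T]
    {μ : Measure Ω} [IsProbabilityMeasure μ] {Z : Ω → S} {U : Ω → I}
    (hZ : Measurable Z) (hU : Measurable U) (hUlaw : μ.map U = volume) (hind : IndepFun U Z μ)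
    (ν : Measure (S × T)) [IsProbabilityMeasure ν] (hν : ν.fst = μ.map Z) :
    ∃ η : Ω → T, Measurable η ∧ μ.map (fun ω => (Z ω, η ω)) = ν := by
  -- The conditional law of the second coordinate is simulated from the uniform variable;
  -- independence of `U` and `Z` then reproduces the disintegration of `ν`.
  obtain ⟨h, hm, hh⟩ := Kernel.exists_measurable_map_eq_unitInterval ν.condKernel
  refine ⟨fun ω => h (Z ω) (U ω), by fun_prop, ?_⟩
  have hprod : μ.map (fun ω => (Z ω, U ω)) = (μ.map Z).prod volume := by
    rw [← hUlaw]
    exact (indepFun_iff_map_prod_eq_prod_map_map hZ.aemeasurable hU.aemeasurable).1 hind.symm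
  have hφ : Measurable fun p : S × I => (p.1, h p.1 p.2) := by fun_prop
  have hcomp : μ.map (fun ω => (Z ω, h (Z ω) (U ω))) =
      ((μ.map Z).prod volume).map (fun p : S × I => (p.1, h p.1 p.2)) := by
    rw [← hprod, Measure.map_map hφ (by fun_prop)]
    rfl
  have : IsProbabilityMeasure (μ.map Z) := Measure.isProbabilityMeasure_map hZ.aemeasurable
  rw [hcomp, ← ν.disintegrate ν.condKernel, hν]
  ext s hs
  rw [Measure.map_apply hφ hs, Measure.prod_apply (hφ hs), Measure.compProd_apply hs]
  refine lintegral_congr fun z => ?_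
  rw [← hh z, Measure.map_apply (by fun_prop) (measurable_prodMk_left hs)]
  rfl

/-- Rectangles determine finite measures on `S × (ι → T)`. -/
theorem measure_prod_pi_ext {S T ι : Type*} [Fintype ι] [MeasurableSpace S] [MeasurableSpace T]
    {μ ν : Measure (S × (ι → T))} [IsFiniteMeasure μ] [IsFiniteMeasure ν]
    (h : ∀ (B : Set S) (A : ι → Set T), MeasurableSet B → (∀ p, MeasurableSet (A p)) →
      μ (B ×ˢ Set.univ.pi A) = ν (B ×ˢ Set.univ.pi A)) : μ = ν := by
  refine Measure.ext_prod fun {B R} hB hR => ?_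
  have key : (μ.restrict (B ×ˢ Set.univ)).map Prod.snd =
      (ν.restrict (B ×ˢ Set.univ)).map Prod.snd := by
    refine ext_of_generate_finite _ generateFrom_pi.symm isPiSystem_pi ?_ ?_
    · rintro _ ⟨A, hA, rfl⟩
      have hA' : ∀ p, MeasurableSet (A p) := fun p => hA p (Set.mem_univ p)
      have hm : MeasurableSet (Set.univ.pi A) := MeasurableSet.univ_pi hA'
      rw [Measure.map_apply measurable_snd hm, Measure.map_apply measurable_snd hm,
        Measure.restrict_apply (measurable_snd hm), Measure.restrict_apply (measurable_snd hm)]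
      have e : (Prod.snd ⁻¹' Set.univ.pi A ∩ B ×ˢ Set.univ : Set (S × (ι → T))) =
          B ×ˢ Set.univ.pi A := by ext; simp [and_comm]
      rw [e, h B A hB hA']
    · have := h B (fun _ => Set.univ) hB fun _ => MeasurableSet.univ
      rw [Measure.map_apply measurable_snd MeasurableSet.univ,
        Measure.map_apply measurable_snd MeasurableSet.univ]
      simpa using this
  have := congrArg (fun m => m R) key
  simp only [Measure.map_apply measurable_snd hR,
    Measure.restrict_apply (measurable_snd hR)] at this
  have e : (Prod.snd ⁻¹' R ∩ B ×ˢ Set.univ : Set (S × (ι → T))) = B ×ˢ R := by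
    ext; simp [and_comm]
  rwa [e] at this

/-- Under mutual conditional independence, the probability of a rectangle is the integral of the
product of the conditional probabilities. -/
theorem MutuallyCondIndepGiven.measure_rectangle {Ω S T ι : Type*} [Fintype ι] [MeasurableSpace Ω]
    [MeasurableSpace S] [MeasurableSpace T] [StandardBorelSpace T] [Nonempty T]
    {μ : Measure Ω} [IsProbabilityMeasure μ] {Z : Ω → S} {W : ι → Ω → T}
    (hZ : Measurable Z) (hW : ∀ p, Measurable (W p)) (hci : MutuallyCondIndepGiven μ Z W)
    {B : Set S} {A : ι → Set T} (hB : MeasurableSet B) (hA : ∀ p, MeasurableSet (A p)) :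
    μ (Z ⁻¹' B ∩ ⋂ p, W p ⁻¹' A p) =
      ∫⁻ z in B, ∏ p, condDistrib (W p) Z μ z (A p) ∂(μ.map Z) := by
  have hmeas : MeasurableSet (⋂ p, W p ⁻¹' A p) := MeasurableSet.iInter fun p => hW p (hA p)
  have h1 : μ⟦⋂ p, W p ⁻¹' A p | MeasurableSpace.comap Z inferInstance⟧ =ᵐ[μ]
      fun ω => ∏ p, (condDistrib (W p) Z μ (Z ω)).real (A p) := by
    have h := hci Finset.univ A fun p _ => hA p
    simp only [Finset.mem_univ, Set.iInter_true] at h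
    refine h.trans ?_
    have h2 : ∀ᵐ ω ∂μ, ∀ p, (condDistrib (W p) Z μ (Z ω)).real (A p) =
        (μ⟦W p ⁻¹' A p | MeasurableSpace.comap Z inferInstance⟧) ω :=
      ae_all_iff.2 fun p => condDistrib_ae_eq_condExp hZ (hW p) (hA p)
    filter_upwards [h2] with ω h2
    simp [h2]
  have hpm : Measurable fun z => ∏ p, (condDistrib (W p) Z μ z).real (A p) := by
    refine Finset.measurable_prod _ fun p _ => ?_
    exact (Kernel.measurable_coe _ (hA p)).ennreal_toReal
  -- Conditional expectations are real-valued, so the identity is first proved for real integrals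
  -- and transferred to `ℝ≥0∞` at the end.
  have h3 : μ.real (Z ⁻¹' B ∩ ⋂ p, W p ⁻¹' A p) =
      ∫ ω in Z ⁻¹' B, ∏ p, (condDistrib (W p) Z μ (Z ω)).real (A p) ∂μ := by
    rw [← setIntegral_congr_ae (hZ hB) (h1.mono fun ω hω _ => hω),
      setIntegral_condExp hZ.comap_le ((integrable_const _).indicator hmeas) ⟨B, hB, rfl⟩,
      setIntegral_indicator hmeas]
    simp
  have h4 : ∀ z, ∏ p, condDistrib (W p) Z μ z (A p) =
      ENNReal.ofReal (∏ p, (condDistrib (W p) Z μ z).real (A p)) := fun z => by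
    rw [ENNReal.ofReal_prod_of_nonneg fun p _ => measureReal_nonneg]
    simp
  simp_rw [h4]
  have hint : Integrable (fun ω => ∏ p, (condDistrib (W p) Z μ (Z ω)).real (A p))
      (μ.restrict (Z ⁻¹' B)) := by
    refine Integrable.of_bound (hpm.comp hZ).aestronglyMeasurable 1 (ae_of_all _ fun ω => ?_)
    rw [Real.norm_of_nonneg (Finset.prod_nonneg fun p _ => measureReal_nonneg)]
    exact Finset.prod_le_one (fun p _ => measureReal_nonneg) fun p _ => measureReal_le_one
  rw [setLIntegral_map hB hpm.ennreal_ofReal hZ, ← ofReal_measureReal, h3,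
    ofReal_integral_eq_lintegral_ofReal hint
      (ae_of_all _ fun ω => Finset.prod_nonneg fun p _ => measureReal_nonneg)]

/-- Joint noise outsourcing: conditionally independent variables are functions of the
conditioning variable and of i.i.d. uniform noise that is independent of it. -/
theorem MutuallyCondIndepGiven.exists_noise {Ω S T ι : Type*} [Fintype ι] [MeasurableSpace Ω]
    [MeasurableSpace S] [MeasurableSpace T] [StandardBorelSpace T] [Nonempty T]
    {μ : Measure Ω} [IsProbabilityMeasure μ] {Z : Ω → S} {W : ι → Ω → T} {U : Ω → I}
    (hci : MutuallyCondIndepGiven μ Z W) (hZ : Measurable Z) (hW : ∀ p, Measurable (W p))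
    (hU : Measurable U) (hUlaw : μ.map U = volume)
    (hind : IndepFun U (fun ω => (Z ω, fun p => W p ω)) μ)
    (f : ι → S → I → T) (hf : ∀ p, Measurable fun q : S × I => f p q.1 q.2)
    (hflaw : ∀ p, ∀ᵐ z ∂(μ.map Z), (volume : Measure I).map (f p z) = condDistrib (W p) Z μ z) :
    ∃ η : ι → Ω → I, IIDUniform μ η ∧ IndepFun (fun ω p => η p ω) Z μ ∧
      ∀ p, ∀ᵐ ω ∂μ, W p ω = f p (Z ω) (η p ω) := by
  have hprob : IsProbabilityMeasure (μ.map Z) := Measure.isProbabilityMeasure_map hZ.aemeasurable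
  have hWm : Measurable fun ω p => W p ω := measurable_pi_iff.2 hW
  have hZW : Measurable fun ω => (Z ω, fun p => W p ω) := hZ.prodMk hWm
  let vol : Measure (ι → I) := Measure.pi fun _ => volume
  have hF : Measurable fun q : S × (ι → I) => fun p => f p q.1 (q.2 p) :=
    measurable_pi_iff.2 fun p =>
      (hf p).comp (g := fun q : S × I => f p q.1 q.2) (f := fun q : S × (ι → I) => (q.1, q.2 p))
        (by fun_prop)
  have hG : Measurable fun q : S × (ι → I) => ((q.1, fun p => f p q.1 (q.2 p)), q.2) :=
    (measurable_fst.prodMk hF).prodMk measurable_snd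
  have hG₁ : Measurable fun q : S × (ι → I) => (q.1, fun p => f p q.1 (q.2 p)) :=
    measurable_fst.prodMk hF
  -- The ideal coupling: `Z` with fresh i.i.d. noise, and outputs computed from them by `f`.
  -- Conditional independence makes its first marginal the law of the actual `(Z, W)`, so noise with
  -- this coupling can be attached to the given variables.
  let ν : Measure ((S × (ι → T)) × (ι → I)) := ((μ.map Z).prod vol).map
    fun q => ((q.1, fun p => f p q.1 (q.2 p)), q.2)
  have : IsProbabilityMeasure ν := Measure.isProbabilityMeasure_map hG.aemeasurable
  have hfst : ν.fst = μ.map fun ω => (Z ω, fun p => W p ω) := by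
    rw [Measure.fst, Measure.map_map measurable_fst hG]
    have : IsProbabilityMeasure (μ.map fun ω => (Z ω, fun p => W p ω)) :=
      Measure.isProbabilityMeasure_map hZW.aemeasurable
    refine measure_prod_pi_ext fun B A hB hA => ?_
    have hR : MeasurableSet (B ×ˢ Set.univ.pi A) := hB.prod (MeasurableSet.univ_pi hA)
    have e : (fun ω => (Z ω, fun p => W p ω)) ⁻¹' (B ×ˢ Set.univ.pi A) =
        Z ⁻¹' B ∩ ⋂ p, W p ⁻¹' A p := by ext; simp
    rw [Measure.map_apply hZW hR, e, hci.measure_rectangle hZ hW hB hA]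
    change (((μ.map Z).prod vol).map fun q : S × (ι → I) => (q.1, fun p => f p q.1 (q.2 p))) _ = _
    rw [Measure.map_apply hG₁ hR, Measure.prod_apply (hG₁ hR), ← lintegral_indicator hB]
    refine lintegral_congr_ae ?_
    filter_upwards [ae_all_iff.2 hflaw] with z hz
    by_cases hzB : z ∈ B
    · have e : (Prod.mk z ⁻¹' ((fun q : S × (ι → I) => (q.1, fun p => f p q.1 (q.2 p))) ⁻¹'
          (B ×ˢ Set.univ.pi A))) = Set.univ.pi fun p => f p z ⁻¹' A p := by
        ext; simp [hzB]
      rw [e, Measure.pi_pi, Set.indicator_of_mem hzB]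
      refine Finset.prod_congr rfl fun p _ => ?_
      have hfz : Measurable (f p z) := (hf p).comp measurable_prodMk_left
      rw [← hz p, Measure.map_apply hfz (hA p)]
    · have e : (Prod.mk z ⁻¹' ((fun q : S × (ι → I) => (q.1, fun p => f p q.1 (q.2 p))) ⁻¹'
          (B ×ˢ Set.univ.pi A))) = ∅ := by
        ext; simp [hzB]
      rw [e, Set.indicator_of_notMem hzB, measure_empty]
  obtain ⟨η, hη, hlaw⟩ := exists_measurable_map_prodMk_eq hZW hU hUlaw hind ν hfst
  have hZη : μ.map (fun ω => (Z ω, η ω)) = (μ.map Z).prod vol := by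
    have h1 : μ.map (fun ω => (Z ω, η ω)) =
        (μ.map fun ω => ((Z ω, fun p => W p ω), η ω)).map fun q => (q.1.1, q.2) := by
      rw [Measure.map_map (by fun_prop) (by fun_prop)]
      rfl
    rw [h1, hlaw, Measure.map_map (by fun_prop) hG]
    exact Measure.map_id
  have hηlaw : μ.map η = vol := by
    have h1 : μ.map η = (μ.map (fun ω => (Z ω, η ω))).map Prod.snd := by
      rw [Measure.map_map (by fun_prop) (by fun_prop)]
      rfl
    rw [h1, hZη, ← Measure.snd, Measure.snd_prod]
  have hηm : ∀ p, Measurable fun ω => η ω p := fun p => (measurable_pi_apply p).comp hη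
  have hη1 : ∀ p, μ.map (fun ω => η ω p) = volume := fun p => by
    have h1 : μ.map (fun ω => η ω p) = (μ.map η).map (Function.eval p) := by
      rw [Measure.map_map (by fun_prop) hη]
      rfl
    rw [h1, hηlaw]
    exact (measurePreserving_eval (fun _ : ι => (volume : Measure I)) p).map_eq
  refine ⟨fun p ω => η ω p, ⟨hηm, hη1, ?_⟩, ?_, fun p => ?_⟩
  · rw [iIndepFun_iff_map_fun_eq_pi_map fun p => (hηm p).aemeasurable]
    simp_rw [hη1]
    exact hηlaw
  · refine IndepFun.symm ?_
    rw [indepFun_iff_map_prod_eq_prod_map_map hZ.aemeasurable hη.aemeasurable, hηlaw]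
    exact hZη
  -- The equation holds surely in the ideal coupling and defines a measurable set, so equality of
  -- laws transfers it to `W` almost surely.
  · have hs : MeasurableSet {q : (S × (ι → T)) × (ι → I) | q.1.2 p = f p q.1.1 (q.2 p)} :=
      measurableSet_eq_fun (by fun_prop)
        ((hf p).comp (f := fun q : (S × (ι → T)) × (ι → I) => (q.1.1, q.2 p)) (by fun_prop))
    have h1 : ∀ᵐ q ∂ν, q.1.2 p = f p q.1.1 (q.2 p) := by
      rw [ae_map_iff hG.aemeasurable hs]
      exact ae_of_all _ fun q => rfl
    rw [← hlaw, ae_map_iff (by fun_prop) hs] at h1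
    exact h1

/-- If each member of a finite family is conditionally independent of the remaining ones, the
family is mutually conditionally independent. -/
theorem mutuallyCondIndepGiven_of_condIndepGiven_rest {Ω S T ι : Type*} [DecidableEq ι]
    [MeasurableSpace Ω] [MeasurableSpace S] [MeasurableSpace T]
    {μ : Measure Ω} [IsProbabilityMeasure μ] {Z : Ω → S} {W : Ω → ι → T}
    (hZ : Measurable Z)
    (h : ∀ i, CondIndepGiven μ Z (fun ω => W ω i) (fun ω (k : {k : ι // k ≠ i}) => W ω k)) :
    MutuallyCondIndepGiven μ Z (fun i ω => W ω i) := by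
  intro s
  induction s using Finset.induction_on with
  | empty =>
    intro A _
    have : (⋂ i ∈ (∅ : Finset ι), (fun ω => W ω i) ⁻¹' A i) = Set.univ := by simp
    rw [this, Set.indicator_univ, Finset.prod_empty, condExp_const hZ.comap_le]
    rfl
  | insert i s hi ih =>
    intro A hA
    have hs := ih A fun j hj => hA j (Finset.mem_insert_of_mem hj)
    -- Since `i ∉ s`, the event concerning `s` depends only on the coordinates other than `i`.
    let R : Set ({k : ι // k ≠ i} → T) := ⋂ j : {j : ι // j ∈ s},
      (fun w => w ⟨j.1, fun e => hi (e ▸ j.2)⟩) ⁻¹' A j.1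
    have hR : MeasurableSet R := MeasurableSet.iInter fun j =>
      measurable_pi_apply _ (hA j.1 (Finset.mem_insert_of_mem j.2))
    have e1 : (fun ω (k : {k : ι // k ≠ i}) => W ω k) ⁻¹' R =
        ⋂ j ∈ s, (fun ω => W ω j) ⁻¹' A j := by
      ext ω
      simp [R]
    have h1 := h i (A i) R (hA i (Finset.mem_insert_self i s)) hR
    rw [e1] at h1
    rw [Finset.set_biInter_insert, Finset.prod_insert hi]
    exact h1.trans (hs.mono fun ω hω => by simp only [Pi.mul_apply, hω])

/-! ### Relabelling, and equivariance as invariance of a joint law -/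

section Relabelling

variable {n : ℕ} {V E V' E' : Type*}

theorem measurable_relabelArray [MeasurableSpace E] (π : Equiv.Perm (Fin n)) :
    Measurable (relabelArray (E := E) π) := by
  unfold relabelArray
  fun_prop

theorem FeatureGraph.measurable_relabel [MeasurableSpace V] [MeasurableSpace E]
    (π : Equiv.Perm (Fin n)) : Measurable (FeatureGraph.relabel (V := V) (E := E) π) := by
  unfold FeatureGraph.relabel relabelArray
  fun_prop

theorem FeatureGraph.relabel_relabel (π τ : Equiv.Perm (Fin n)) (g : FeatureGraph n V E) :
    (g.relabel π).relabel τ = g.relabel (π * τ) := rfl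

/-- Given joint exchangeability of `G`, conditional equivariance of `H` amounts to
joint invariance of the law of `(G, H)`. -/
theorem condEquivariant_iff {Ω : Type*} [MeasurableSpace Ω]
    [MeasurableSpace V] [MeasurableSpace E] [MeasurableSpace V'] [MeasurableSpace E']
    {μ : Measure Ω} [IsProbabilityMeasure μ]
    {G : Ω → FeatureGraph n V E} {H : Ω → FeatureGraph n V' E'}
    (hG : Measurable G) (hH : Measurable H) (hexch : JointlyExchangeable μ G) :
    CondEquivariant μ G H ↔ ∀ π : Equiv.Perm (Fin n),
      μ.map (fun ω => ((G ω).relabel π, (H ω).relabel π)) = μ.map (fun ω => (G ω, H ω)) := by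
  have hGπ : ∀ π : Equiv.Perm (Fin n), Measurable fun ω => (G ω).relabel π := fun π =>
    (FeatureGraph.measurable_relabel π).comp hG
  have hHπ : ∀ π : Equiv.Perm (Fin n), Measurable fun ω => (H ω).relabel π := fun π =>
    (FeatureGraph.measurable_relabel π).comp hH
  have hBm : ∀ {B : Set (FeatureGraph n V E)}, MeasurableSet B → MeasurableSet {ω | G ω ∈ B} :=
    fun hB => hG hB
  have hBπm : ∀ (π : Equiv.Perm (Fin n)) {B : Set (FeatureGraph n V E)}, MeasurableSet B →
      MeasurableSet {ω | (G ω).relabel π ∈ B} := fun π _ hB => hGπ π hB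
  have hmass : ∀ (π : Equiv.Perm (Fin n)) {B : Set (FeatureGraph n V E)}, MeasurableSet B →
      μ {ω | (G ω).relabel π ∈ B} = μ {ω | G ω ∈ B} := fun π B hB => (hexch π).measure_mem_eq hB
  constructor
  · intro h π
    have : IsProbabilityMeasure (μ.map (fun ω => ((G ω).relabel π, (H ω).relabel π))) :=
      Measure.isProbabilityMeasure_map ((hGπ π).prodMk (hHπ π)).aemeasurable
    refine Measure.ext_prod fun {B A} hB hA => ?_
    rw [Measure.map_apply ((hGπ π).prodMk (hHπ π)) (hB.prod hA),
      Measure.map_apply (hG.prodMk hH) (hB.prod hA)]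
    change μ ({ω | (G ω).relabel π ∈ B} ∩ {ω | (H ω).relabel π ∈ A}) =
      μ ({ω | G ω ∈ B} ∩ {ω | H ω ∈ A})
    -- Multiplying by the mass of the conditioning event remains valid when that mass is zero, so
    -- null events need no separate case.
    rw [← cond_mul_eq_inter (hBπm π hB), ← cond_mul_eq_inter (hBm hB), hmass π hB, h π A B hA hB]
  · intro h π A B hA hB
    have key : μ ({ω | (G ω).relabel π ∈ B} ∩ {ω | (H ω).relabel π ∈ A}) =
        μ ({ω | G ω ∈ B} ∩ {ω | H ω ∈ A}) := by
      have := congrArg (fun m => m (B ×ˢ A)) (h π)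
      simp only [Measure.map_apply ((hGπ π).prodMk (hHπ π)) (hB.prod hA),
        Measure.map_apply (hG.prodMk hH) (hB.prod hA)] at this
      exact this
    rw [cond_apply (hBm hB), cond_apply (hBπm π hB), key, hmass π hB]

end Relabelling

/-! ### Canonical forms: equivariance and recovery of the graph -/

section Decoding

variable {n : ℕ} {V E : Type*}

/-- A measurable map on unordered pairs that recovers `a` from `{a, a}`. -/
theorem exists_measurable_sym2_diag (V : Type*) [MeasurableSpace V] [StandardBorelSpace V] :
    ∃ d : Sym2 V → V, Measurable d ∧ ∀ a, d s(a, a) = a := by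
  classical
  obtain ⟨φ, hφ, hinj⟩ := exists_inj_real V
  refine ⟨fun p => Quot.lift (fun q : V × V => if φ q.1 ≤ φ q.2 then q.1 else q.2) ?_ p, ?_, ?_⟩
  · rintro ⟨a, b⟩ ⟨c, d⟩ h
    cases h
    · rfl
    · dsimp only
      split_ifs with h₁ h₂ h₂
      · exact hinj (le_antisymm h₁ h₂)
      · rfl
      · rfl
      · exact absurd (le_of_not_ge h₁) h₂
  · refine (measurable_from_quotient (s := Sym2.Rel.setoid V)).2 ?_
    change Measurable fun q : V × V => if φ q.1 ≤ φ q.2 then q.1 else q.2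
    exact Measurable.ite (measurableSet_le (by fun_prop) (by fun_prop)) measurable_fst
      measurable_snd
  · intro a
    change (if φ a ≤ φ a then a else a) = a
    simp

theorem augmentedArray_relabel (i j : Fin n) (g : FeatureGraph n V E) (π : Equiv.Perm (Fin n)) :
    augmentedArray i j (g.relabel π) = (augmentedArray (π i) (π j) g).relabel π := by
  refine Prod.ext rfl ?_
  ext k
  simp [augmentedArray, MarkedArray.relabel]

/-- The two augmented arrays lie in one orbit, marks included, so canonicalization identifies them.
This is the source of equivariance in the converse direction. -/
theorem augmentedCanonicalForm_relabel [MeasurableSpace V] [MeasurableSpace E]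
    (C : Canonicalization n (AugEntry V E)) (i j : Fin n) (g : FeatureGraph n V E)
    (π : Equiv.Perm (Fin n)) :
    augmentedCanonicalForm C i j (g.relabel π) = augmentedCanonicalForm C (π i) (π j) g := by
  rw [augmentedCanonicalForm, augmentedArray_relabel, C.canon_relabel]
  rfl

theorem measurable_sym2_mk (D : Type*) [MeasurableSpace D] :
    Measurable fun q : D × D => s(q.1, q.2) :=
  measurable_quotient_mk'' (s := Sym2.Rel.setoid D)

theorem measurable_augmentedArray [MeasurableSpace V] [MeasurableSpace E] (i j : Fin n) :
    Measurable (augmentedArray (V := V) (E := E) i j) := by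
  refine Measurable.prodMk ?_ measurable_const
  refine measurable_pi_iff.2 fun k => measurable_pi_iff.2 fun l => ?_
  refine Measurable.prodMk (by fun_prop) (Measurable.prodMk ?_ ?_)
  · exact (measurable_sym2_mk V).comp (by fun_prop : Measurable fun G : FeatureGraph n V E => (G.1 k, G.1 l))
  · exact (measurable_sym2_mk (E × E)).comp (by fun_prop : Measurable fun G : FeatureGraph n V E =>
      ((G.2 i l, G.2 j l), (G.2 k i, G.2 k j)))

theorem measurable_augmentedCanonicalForm [MeasurableSpace V] [MeasurableSpace E]
    (C : Canonicalization n (AugEntry V E)) (i j : Fin n) :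
    Measurable (augmentedCanonicalForm C i j) :=
  C.measurable_canon.comp (measurable_augmentedArray i j)

/-- The canonical form determines the feature graph and the marked pair up to a common
relabelling, in a measurable way. -/
theorem exists_measurable_decode [MeasurableSpace V] [MeasurableSpace E] [StandardBorelSpace V] :
    ∃ dec : MarkedArray n (AugEntry V E) → FeatureGraph n V E, Measurable dec ∧
      ∀ (C : Canonicalization n (AugEntry V E)) (i j : Fin n) (g : FeatureGraph n V E),
        ∃ π : Equiv.Perm (Fin n), dec (augmentedCanonicalForm C i j g) = g.relabel π ∧
          (augmentedCanonicalForm C i j g).2 = {π.symm i, π.symm j} := by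
  obtain ⟨d, hd, hdiag⟩ := exists_measurable_sym2_diag V
  refine ⟨fun M => (fun k => d (M.1 k k).2.1, fun k l => (M.1 k l).1), by fun_prop, ?_⟩
  intro C i j g
  obtain ⟨π, hπ⟩ := C.canon_mem_orbit (augmentedArray i j g)
  refine ⟨π, ?_, ?_⟩
  · rw [augmentedCanonicalForm, hπ]
    refine Prod.ext (funext fun k => ?_) rfl
    exact hdiag _
  · rw [augmentedCanonicalForm, hπ]
    ext k
    simp [augmentedArray, MarkedArray.relabel, Equiv.eq_symm_apply]

end Decoding

/-! ### Conditional laws as functions of the canonical form -/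

/-- Joint invariance of the law of a random feature graph and an array under relabelling. -/
def InvariantLaw {Ω V E T : Type*} [MeasurableSpace Ω] [MeasurableSpace V] [MeasurableSpace E]
    [MeasurableSpace T] {n : ℕ} (μ : Measure Ω) (G : Ω → FeatureGraph n V E)
    (W : Ω → Fin n → Fin n → T) : Prop :=
  ∀ π : Equiv.Perm (Fin n),
    μ.map (fun ω => ((G ω).relabel π, relabelArray π (W ω))) = μ.map (fun ω => (G ω, W ω))

section Kernel

variable {Ω V E T : Type*} [MeasurableSpace Ω] [MeasurableSpace V] [MeasurableSpace E]
  [MeasurableSpace T] [StandardBorelSpace T] [Nonempty T] {n : ℕ} {μ : Measure Ω}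
  [IsProbabilityMeasure μ] {G : Ω → FeatureGraph n V E} {W : Ω → Fin n → Fin n → T}

/-- The conditional laws of the entries of an invariant array are equivariant. -/
theorem InvariantLaw.condDistrib_relabel (hinv : InvariantLaw μ G W) (hG : Measurable G)
    (hW : Measurable W) (π : Equiv.Perm (Fin n)) (i j : Fin n) :
    ∀ᵐ g ∂(μ.map G), condDistrib (fun ω => W ω (π i) (π j)) G μ g =
      condDistrib (fun ω => W ω i j) G μ (g.relabel π) := by
  have hWij : ∀ i j, Measurable fun ω => W ω i j := fun i j => by fun_prop
  have hπ := FeatureGraph.measurable_relabel (V := V) (E := E) π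
  have hπ' := FeatureGraph.measurable_relabel (V := V) (E := E) π⁻¹
  have hGπ : Measurable fun ω => (G ω).relabel π := hπ.comp hG
  have h1 : μ.map (fun ω => ((G ω).relabel π, W ω (π i) (π j))) =
      μ.map (fun ω => (G ω, W ω i j)) := by
    have hp : Measurable fun q : FeatureGraph n V E × (Fin n → Fin n → T) => (q.1, q.2 i j) := by
      fun_prop
    have hWπ : Measurable fun ω => relabelArray π (W ω) := (measurable_relabelArray π).comp hW
    have := congrArg (Measure.map fun q : FeatureGraph n V E × (Fin n → Fin n → T) =>
      (q.1, q.2 i j)) (hinv π)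
    rw [Measure.map_map hp (hGπ.prodMk hWπ),
      Measure.map_map hp (hG.prodMk hW)] at this
    exact this
  have h2 : μ.map (fun ω => (G ω).relabel π) = μ.map G := by
    have := congrArg Measure.fst h1
    rwa [Measure.fst_map_prodMk (hWij _ _), Measure.fst_map_prodMk (hWij _ _)] at this
  let κ := condDistrib (fun ω => W ω i j) G μ
  -- A conditional law is a.e. unique, so it suffices that the relabelled kernel disintegrates the
  -- law of the pair; this follows by undoing the relabelling in `h1`.
  refine condDistrib_ae_eq_of_measure_eq_compProd (κ := κ.comap _ hπ) G
    (hWij _ _).aemeasurable ?_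
  ext s hs
  have hpair : Measurable fun q : FeatureGraph n V E × T => (q.1.relabel π⁻¹, q.2) :=
    (hπ'.comp measurable_fst).prodMk measurable_snd
  have hinvol : ∀ g : FeatureGraph n V E, (g.relabel π).relabel π⁻¹ = g := fun g => by
    rw [FeatureGraph.relabel_relabel, mul_inv_cancel]
    rfl
  have h3 : μ.map (fun ω => (G ω, W ω (π i) (π j))) =
      (μ.map G ⊗ₘ κ).map fun q => (q.1.relabel π⁻¹, q.2) := by
    rw [compProd_map_condDistrib (hWij i j).aemeasurable, ← h1,
      Measure.map_map hpair (hGπ.prodMk (hWij _ _))]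
    refine congrArg (fun F => μ.map F) (funext fun ω => ?_)
    exact Prod.ext (hinvol (G ω)).symm rfl
  rw [h3, Measure.map_apply hpair hs, Measure.compProd_apply (hpair hs),
    Measure.compProd_apply hs, ← h2, lintegral_map (Kernel.measurable_kernel_prodMk_left (hpair hs))
      hGπ, h2, lintegral_map (Kernel.measurable_kernel_prodMk_left hs) hG]
  refine lintegral_congr fun ω => ?_
  rw [Kernel.comap_apply]
  congr 1
  ext y
  simp [hinvol]

/-- The conditional laws of the entries of a symmetric invariant array are given by one measurable
function of the augmented canonical form. -/
theorem InvariantLaw.exists_canonical_condDistrib [StandardBorelSpace V]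
    (hinv : InvariantLaw μ G W) (hG : Measurable G) (hW : Measurable W)
    (hsymm : ∀ ω i j, W ω i j = W ω j i) (C : Canonicalization n (AugEntry V E)) :
    ∃ K : MarkedArray n (AugEntry V E) → {m : Measure T // IsProbabilityMeasure m},
      Measurable K ∧ ∀ i j, ∀ᵐ g ∂(μ.map G),
        (K (augmentedCanonicalForm C i j g)).1 = condDistrib (fun ω => W ω i j) G μ g := by
  classical
  obtain ⟨dec, hdec, hcanon⟩ := exists_measurable_decode (n := n) (V := V) (E := E)
  obtain ⟨t₀⟩ := ‹Nonempty T›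
  let κ : Fin n → Fin n → FeatureGraph n V E → {m : Measure T // IsProbabilityMeasure m} :=
    fun i j g => ⟨condDistrib (fun ω => W ω i j) G μ g, inferInstance⟩
  have hκ : ∀ i j, Measurable (κ i j) := fun i j => (Kernel.measurable _).subtype_mk
  have hκsymm : ∀ i j, κ i j = κ j i := fun i j => by
    simp only [κ, hsymm _ i j]
  -- The marks form an unordered set, so `F` has to choose an order; symmetry of `W` makes the
  -- choice immaterial. The Dirac mass is a dummy value for sets that are not of the form `{i, j}`.
  let F : FeatureGraph n V E → Set (Fin n) → {m : Measure T // IsProbabilityMeasure m} :=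
    fun g S => if h : ∃ p : Fin n × Fin n, S = {p.1, p.2}
      then κ h.choose.1 h.choose.2 g else ⟨Measure.dirac t₀, inferInstance⟩
  have hFpair : ∀ i j g, F g {i, j} = κ i j g := fun i j g => by
    have h : ∃ p : Fin n × Fin n, ({i, j} : Set (Fin n)) = {p.1, p.2} := ⟨(i, j), rfl⟩
    have hF : F g {i, j} = κ h.choose.1 h.choose.2 g := dif_pos h
    rw [hF]
    rcases Set.pair_eq_pair_iff.1 h.choose_spec with ⟨h1, h2⟩ | ⟨h1, h2⟩
    · rw [← h1, ← h2]
    · rw [← h1, ← h2, hκsymm]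
  have hFm : ∀ S, Measurable fun g => F g S := fun S => by
    by_cases h : ∃ p : Fin n × Fin n, S = {p.1, p.2}
    · simp only [F, dif_pos h]
      exact hκ _ _
    · simp only [F, dif_neg h]
      exact measurable_const
  have : MeasurableSingletonClass (Set (Fin n)) :=
    inferInstanceAs (MeasurableSingletonClass (Fin n → Prop))
  have hFjoint : Measurable fun q : FeatureGraph n V E × Set (Fin n) => F q.1 q.2 :=
    measurable_from_prod_countable_left hFm
  refine ⟨fun M => F (dec M) M.2, hFjoint.comp (hdec.prodMk measurable_snd), fun i j => ?_⟩
  -- The permutation produced by decoding depends on `g`, so one null set must serve for all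
  -- permutations; there are finitely many.
  have hall : ∀ᵐ g ∂(μ.map G), ∀ (π : Equiv.Perm (Fin n)),
      condDistrib (fun ω => W ω i j) G μ g =
        condDistrib (fun ω => W ω (π.symm i) (π.symm j)) G μ (g.relabel π) :=
    ae_all_iff.2 fun π => by
      simpa using hinv.condDistrib_relabel hG hW π (π.symm i) (π.symm j)
  filter_upwards [hall] with g hg
  obtain ⟨π, h1, h2⟩ := hcanon C i j g
  rw [h1, h2, hFpair, hg π]

/-- Functional representation of the entries of a symmetric invariant array: there is one
measurable function of a uniform variable and the augmented canonical form whose laws are the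
conditional laws of the entries. It takes the same values at `(i, j)` and `(j, i)`. -/
theorem InvariantLaw.exists_outsourcing_function [StandardBorelSpace V]
    (hinv : InvariantLaw μ G W) (hG : Measurable G) (hW : Measurable W)
    (hsymm : ∀ ω i j, W ω i j = W ω j i) (C : Canonicalization n (AugEntry V E)) :
    ∃ f : I × MarkedArray n (AugEntry V E) → T, Measurable f ∧
      (∀ i j, ∀ᵐ g ∂(μ.map G),
        (volume : Measure I).map (fun u => f (u, augmentedCanonicalForm C i j g)) =
          condDistrib (fun ω => W ω i j) G μ g) ∧
      ∀ i j, ∀ᵐ g ∂(μ.map G), ∀ u,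
        f (u, augmentedCanonicalForm C i j g) = f (u, augmentedCanonicalForm C j i g) := by
  obtain ⟨K, hK, hKlaw⟩ := hinv.exists_canonical_condDistrib hG hW hsymm C
  let κ : Kernel {m : Measure T // IsProbabilityMeasure m} T := ⟨Subtype.val, measurable_subtype_coe⟩
  have : IsMarkovKernel κ := ⟨fun m => m.2⟩
  -- Randomizing over the space of probability measures makes the output depend on the canonical
  -- form only through `K`. The forms of `(i, j)` and `(j, i)` may differ, as their inner pairs are
  -- ordered, but `K` agrees on them a.e.; this gives the last clause.
  obtain ⟨r, hr, hrlaw⟩ := Kernel.exists_measurable_map_eq_unitInterval κ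
  refine ⟨fun q => r (K q.2) q.1, ?_, fun i j => ?_, fun i j => ?_⟩
  · exact hr.comp ((hK.comp measurable_snd).prodMk measurable_fst)
  · filter_upwards [hKlaw i j] with g hg
    rw [← hg]
    exact hrlaw _
  · filter_upwards [hKlaw i j, hKlaw j i] with g hg hg' u
    have : K (augmentedCanonicalForm C i j g) = K (augmentedCanonicalForm C j i g) := by
      refine Subtype.ext ?_
      rw [hg, hg']
      simp only [hsymm _ i j]
    simp only [this]

end Kernel

/-! ### Symmetric noise and transfer of invariance -/

/-- Conditional independence given `Z` only depends on the `σ`-algebra generated by `Z`. -/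
theorem MutuallyCondIndepGiven.of_comp {Ω ι S S' T : Type*} [MeasurableSpace Ω]
    [MeasurableSpace S] [MeasurableSpace S'] [MeasurableSpace T] {μ : Measure Ω} {Z : Ω → S}
    {W : ι → Ω → T} (h : MutuallyCondIndepGiven μ Z W) {φ : S → S'} {ψ : S' → S}
    (hφ : Measurable φ) (hψ : Measurable ψ) (hψφ : ∀ z, ψ (φ z) = z) :
    MutuallyCondIndepGiven μ (fun ω => φ (Z ω)) W := by
  have e : MeasurableSpace.comap (fun ω => φ (Z ω)) inferInstance =
      MeasurableSpace.comap Z inferInstance := by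
    refine le_antisymm ?_ ?_
    · rintro _ ⟨s, hs, rfl⟩
      exact ⟨φ ⁻¹' s, hφ hs, rfl⟩
    · rintro _ ⟨s, hs, rfl⟩
      refine ⟨ψ ⁻¹' s, hψ hs, ?_⟩
      ext ω
      simp [hψφ]
  intro s A hA
  rw [e]
  exact h s A hA

/-- The position of the entry `{i, j}` of a symmetric array in its lower triangle. -/
def lowerIdx {n : ℕ} (i j : Fin n) : LowerIdx n := ⟨(max i j, min i j), min_le_max⟩

theorem lowerIdx_comm {n : ℕ} (i j : Fin n) : lowerIdx i j = lowerIdx j i := by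
  simp only [lowerIdx, max_comm i j, min_comm i j]

theorem lowerIdx_self {n : ℕ} (p : LowerIdx n) : lowerIdx p.1.1 p.1.2 = p := by
  obtain ⟨⟨i, j⟩, h⟩ := p
  simp only [lowerIdx, max_eq_left h, min_eq_right h]

theorem lowerIdx_map_max_min {n : ℕ} (π : Fin n → Fin n) (i j : Fin n) :
    lowerIdx (π (max i j)) (π (min i j)) = lowerIdx (π i) (π j) := by
  rcases le_total i j with h | h
  · rw [max_eq_right h, min_eq_left h, lowerIdx_comm]
  · rw [max_eq_left h, min_eq_right h]

/-- A permutation acts on unordered pairs, each listed once in the lower triangle, and the inverse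
permutation undoes the action. -/
theorem lowerIdx_perm_injective {n : ℕ} (π : Equiv.Perm (Fin n)) :
    Function.Injective fun p : LowerIdx n => lowerIdx (π p.1.1) (π p.1.2) := by
  have hleft : ∀ p : LowerIdx n, lowerIdx (π.symm (lowerIdx (π p.1.1) (π p.1.2)).1.1)
      (π.symm (lowerIdx (π p.1.1) (π p.1.2)).1.2) = p := fun p => by
    change lowerIdx (π.symm (max (π p.1.1) (π p.1.2))) (π.symm (min (π p.1.1) (π p.1.2))) = p
    rw [lowerIdx_map_max_min, π.symm_apply_apply, π.symm_apply_apply, lowerIdx_self]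
  intro p q h
  rw [← hleft p, ← hleft q]
  simp only at h
  rw [h]

/-- The joint law of i.i.d. uniform variables is invariant under injective reindexing. -/
theorem IIDUniform.map_reindex {Ω ι : Type*} [Fintype ι] [MeasurableSpace Ω] {μ : Measure Ω}
    [IsProbabilityMeasure μ] {η : ι → Ω → I} (h : IIDUniform μ η) {s : ι → ι}
    (hs : Function.Injective s) :
    μ.map (fun ω p => η (s p) ω) = μ.map (fun ω p => η p ω) := by
  rw [(iIndepFun_iff_map_fun_eq_pi_map fun p => (h.measurable p).aemeasurable).1 h.indep,
    (iIndepFun_iff_map_fun_eq_pi_map fun p => (h.measurable (s p)).aemeasurable).1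
      (h.indep.precomp hs)]
  simp only [h.law]

/-- If `H` is an equivariant function of `Z` and of independent noise, and the laws of `Z` and of
the noise are invariant, then the joint law of `(Z, H)` is invariant. -/
theorem map_prodMk_eq_of_equivariant {Ω S T R : Type*} [MeasurableSpace Ω] [MeasurableSpace S]
    [MeasurableSpace T] [MeasurableSpace R] {μ : Measure Ω} [IsProbabilityMeasure μ]
    {Z : Ω → S} {e : Ω → T} {H : Ω → R} {Φ : S × T → R} {θ : S → S} {τ : T → T} {ρ : R → R}
    (hZ : Measurable Z) (he : Measurable e) (hΦ : Measurable Φ) (hθ : Measurable θ)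
    (hτ : Measurable τ) (hind : IndepFun e Z μ)
    (hZinv : μ.map (fun ω => θ (Z ω)) = μ.map Z) (heinv : μ.map (fun ω => τ (e ω)) = μ.map e)
    (hequiv : ∀ z t, Φ (θ z, τ t) = ρ (Φ (z, t))) (hH : ∀ᵐ ω ∂μ, H ω = Φ (Z ω, e ω)) :
    μ.map (fun ω => (θ (Z ω), ρ (H ω))) = μ.map (fun ω => (Z ω, H ω)) := by
  have hθZ : Measurable fun ω => θ (Z ω) := hθ.comp hZ
  have hτe : Measurable fun ω => τ (e ω) := hτ.comp he
  -- Independence makes both joint laws products, and each factor is invariant.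
  have hZe : μ.map (fun ω => (θ (Z ω), τ (e ω))) = μ.map (fun ω => (Z ω, e ω)) := by
    rw [(indepFun_iff_map_prod_eq_prod_map_map hZ.aemeasurable he.aemeasurable).1 hind.symm,
      (indepFun_iff_map_prod_eq_prod_map_map hθZ.aemeasurable hτe.aemeasurable).1
        (hind.symm.comp hθ hτ), hZinv, heinv]
  have hF : Measurable fun q : S × T => (q.1, Φ q) := measurable_fst.prodMk hΦ
  calc μ.map (fun ω => (θ (Z ω), ρ (H ω)))
      = μ.map (fun ω => (θ (Z ω), Φ (θ (Z ω), τ (e ω)))) := by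
        refine Measure.map_congr ?_
        filter_upwards [hH] with ω hω
        rw [hω, hequiv]
    _ = (μ.map (fun ω => (θ (Z ω), τ (e ω)))).map (fun q => (q.1, Φ q)) := by
        rw [Measure.map_map hF (hθZ.prodMk hτe)]
        rfl
    _ = μ.map (fun ω => (Z ω, Φ (Z ω, e ω))) := by
        rw [hZe, Measure.map_map hF (hZ.prodMk he)]
        rfl
    _ = μ.map (fun ω => (Z ω, H ω)) := by
        refine Measure.map_congr ?_
        filter_upwards [hH] with ω hω
        rw [hω]

theorem measurable_stack {n : ℕ} {E E' : Type*} [MeasurableSpace E] [MeasurableSpace E'] :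
    Measurable fun q : (Fin n → Fin n → E) × (Fin n → Fin n → E') => stack q.1 q.2 := by
  unfold stack
  fun_prop

/-! ### Edge and vertex representations, in both directions -/

section Main

variable {Ω V E T : Type*} [MeasurableSpace Ω] [MeasurableSpace V] [MeasurableSpace E]
  [MeasurableSpace T] {n : ℕ} {μ : Measure Ω} [IsProbabilityMeasure μ]

/-- Edge features that are generated from the canonical forms and symmetric i.i.d. noise are
jointly invariant with the input. -/
theorem invariantLaw_of_edge_representation {G : Ω → FeatureGraph n V E}
    {W : Ω → Fin n → Fin n → T} (hG : Measurable G) (hexch : JointlyExchangeable μ G)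
    (C : Canonicalization n (AugEntry V E))
    {f : I × E × Sym2 V × MarkedArray n (AugEntry V E) → T} (hf : Measurable f)
    {η : Fin n → Fin n → Ω → I} (hηsymm : ∀ i j, η i j = η j i)
    (hη : IIDUniform μ (fun p : LowerIdx n => η p.1.1 p.1.2))
    (hind : IndepFun (fun ω (p : LowerIdx n) => η p.1.1 p.1.2 ω) G μ)
    (hW : ∀ i j, ∀ᵐ ω ∂μ, W ω i j = f (η i j ω, (G ω).2 i j, s((G ω).1 i, (G ω).1 j),
      augmentedCanonicalForm C i j (G ω))) :
    InvariantLaw μ G W := by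
  intro π
  have hηlow : ∀ i j, η (lowerIdx i j).1.1 (lowerIdx i j).1.2 = η i j := fun i j => by
    change η (max i j) (min i j) = η i j
    rcases le_total i j with h | h
    · rw [max_eq_right h, min_eq_left h, hηsymm]
    · rw [max_eq_left h, min_eq_right h]
  -- The noise is moved by the action of `π` on unordered pairs, expressed in lower-triangular
  -- positions.
  refine map_prodMk_eq_of_equivariant (e := fun ω (p : LowerIdx n) => η p.1.1 p.1.2 ω)
    (Φ := fun q : FeatureGraph n V E × (LowerIdx n → I) => fun i j =>
      f (q.2 (lowerIdx i j), q.1.2 i j, s(q.1.1 i, q.1.1 j), augmentedCanonicalForm C i j q.1))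
    (τ := fun t p => t (lowerIdx (π p.1.1) (π p.1.2))) hG
    (measurable_pi_iff.2 hη.measurable) ?_ (FeatureGraph.measurable_relabel π) (by fun_prop) hind
    (hexch π).map_eq ?_ ?_ ?_
  · refine measurable_pi_iff.2 fun i => measurable_pi_iff.2 fun j => hf.comp ?_
    refine Measurable.prodMk (by fun_prop) (Measurable.prodMk (by fun_prop)
      (Measurable.prodMk ?_ ?_))
    · exact (measurable_sym2_mk V).comp (by fun_prop :
        Measurable fun q : FeatureGraph n V E × (LowerIdx n → I) => (q.1.1 i, q.1.1 j))
    · exact (measurable_augmentedCanonicalForm C i j).comp measurable_fst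
  · exact hη.map_reindex (lowerIdx_perm_injective π)
  · intro g t
    funext i j
    simp only [augmentedCanonicalForm_relabel, relabelArray]
    congr 1
    exact Prod.ext (congrArg t (lowerIdx_map_max_min π i j)) rfl
  · filter_upwards [ae_all_iff.2 fun i => ae_all_iff.2 (hW i)] with ω hω
    funext i j
    rw [hω i j, ← hηlow i j]

/-- Vertex features that are generated from the canonical forms and i.i.d. noise are
jointly invariant with the input. -/
theorem map_relabel_eq_of_vertex_representation {G : Ω → FeatureGraph n V E}
    {Y : Ω → Fin n → T} (hG : Measurable G)
    (hexch : ∀ π : Equiv.Perm (Fin n), μ.map (fun ω => (G ω).relabel π) = μ.map G)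
    (C : Canonicalization n (AugEntry V E))
    {f : I × V × E × MarkedArray n (AugEntry V E) → T} (hf : Measurable f)
    {η : Fin n → Ω → I} (hη : IIDUniform μ η) (hind : IndepFun (fun ω i => η i ω) G μ)
    (hY : ∀ i, ∀ᵐ ω ∂μ, Y ω i = f (η i ω, (G ω).1 i, (G ω).2 i i,
      augmentedCanonicalForm C i i (G ω))) (π : Equiv.Perm (Fin n)) :
    μ.map (fun ω => ((G ω).relabel π, fun i => Y ω (π i))) = μ.map (fun ω => (G ω, Y ω)) := by
  refine map_prodMk_eq_of_equivariant (e := fun ω i => η i ω) (ρ := fun y i => y (π i))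
    (Φ := fun q : FeatureGraph n V E × (Fin n → I) => fun i =>
      f (q.2 i, q.1.1 i, q.1.2 i i, augmentedCanonicalForm C i i q.1))
    (τ := fun t i => t (π i)) hG
    (measurable_pi_iff.2 hη.measurable) ?_ (FeatureGraph.measurable_relabel π) (by fun_prop) hind
    (hexch π) (hη.map_reindex π.injective) ?_ ?_
  · refine measurable_pi_iff.2 fun i => hf.comp ?_
    refine Measurable.prodMk (by fun_prop) (Measurable.prodMk (by fun_prop)
      (Measurable.prodMk (by fun_prop) ?_))
    exact (measurable_augmentedCanonicalForm C i i).comp measurable_fst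
  · intro g t
    funext i
    simp only [augmentedCanonicalForm_relabel]
    rfl
  · filter_upwards [ae_all_iff.2 hY] with ω hω
    funext i
    exact hω i

variable [StandardBorelSpace V] [StandardBorelSpace T] [Nonempty T]

/-- Conditionally independent, jointly invariant symmetric edge features are generated from the
canonical forms and symmetric i.i.d. noise. -/
theorem InvariantLaw.exists_edge_representation {G : Ω → FeatureGraph n V E}
    {W : Ω → Fin n → Fin n → T} {U : Ω → I} (hinv : InvariantLaw μ G W) (hG : Measurable G)
    (hW : Measurable W) (hsymm : ∀ ω i j, W ω i j = W ω j i)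
    (hU : Measurable U) (hUlaw : μ.map U = volume)
    (hind : IndepFun U (fun ω => (G ω, W ω)) μ)
    (hci : MutuallyCondIndepGiven μ G (fun (p : LowerIdx n) ω => W ω p.1.1 p.1.2))
    (C : Canonicalization n (AugEntry V E)) :
    ∃ f : I × MarkedArray n (AugEntry V E) → T, Measurable f ∧ ∃ η : Fin n → Fin n → Ω → I,
      (∀ i j, η i j = η j i) ∧ IIDUniform μ (fun p : LowerIdx n => η p.1.1 p.1.2) ∧
      IndepFun (fun ω (p : LowerIdx n) => η p.1.1 p.1.2 ω) G μ ∧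
      ∀ i j, ∀ᵐ ω ∂μ, W ω i j = f (η i j ω, augmentedCanonicalForm C i j (G ω)) := by
  obtain ⟨f, hf, hlaw, hfsymm⟩ := hinv.exists_outsourcing_function hG hW hsymm C
  have hind' : IndepFun U (fun ω => (G ω, fun p : LowerIdx n => W ω p.1.1 p.1.2)) μ :=
    hind.comp (φ := id) (ψ := fun q : FeatureGraph n V E × (Fin n → Fin n → T) =>
      (q.1, fun p : LowerIdx n => q.2 p.1.1 p.1.2)) measurable_id (by fun_prop)
  obtain ⟨η, hiid, hηind, hrep⟩ := hci.exists_noise hG (fun p => by fun_prop) hU hUlaw hind'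
    (fun p g u => f (u, augmentedCanonicalForm C p.1.1 p.1.2 g))
    (fun p => hf.comp (measurable_snd.prodMk
      ((measurable_augmentedCanonicalForm C _ _).comp measurable_fst)))
    (fun p => hlaw p.1.1 p.1.2)
  have hη : (fun p : LowerIdx n => η (lowerIdx p.1.1 p.1.2)) = η :=
    funext fun p => by rw [lowerIdx_self]
  refine ⟨f, hf, fun i j => η (lowerIdx i j), fun i j => congrArg η (lowerIdx_comm i j), ?_, ?_, ?_⟩
  · rwa [hη]
  · simp only [lowerIdx_self]
    exact hηind
  · intro i j
    have hlow : ∀ i j, j ≤ i → ∀ᵐ ω ∂μ,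
        W ω i j = f (η (lowerIdx i j) ω, augmentedCanonicalForm C i j (G ω)) := fun i j h => by
      have e : lowerIdx i j = ⟨(i, j), h⟩ := lowerIdx_self ⟨(i, j), h⟩
      rw [e]
      exact hrep ⟨(i, j), h⟩
    rcases le_total j i with h | h
    · exact hlow i j h
    -- Above the diagonal, the entry and its noise are those of the mirrored position, and `f`
    -- agrees a.s. on the two canonical forms.
    · filter_upwards [hlow j i h, ae_of_ae_map hG.aemeasurable (hfsymm i j)] with ω h1 h2
      rw [hsymm, h1, h2, lowerIdx_comm]

/-- Conditionally independent, jointly invariant vertex features are generated from the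
canonical forms and i.i.d. noise. -/
theorem exists_vertex_representation {G : Ω → FeatureGraph n V E}
    {Y : Ω → Fin n → T} {U : Ω → I} (hG : Measurable G) (hY : Measurable Y)
    (hinv : ∀ π : Equiv.Perm (Fin n),
      μ.map (fun ω => ((G ω).relabel π, fun i => Y ω (π i))) = μ.map (fun ω => (G ω, Y ω)))
    (hU : Measurable U) (hUlaw : μ.map U = volume) (hind : IndepFun U (fun ω => (G ω, Y ω)) μ)
    (hci : MutuallyCondIndepGiven μ G (fun i ω => Y ω i))
    (C : Canonicalization n (AugEntry V E)) :
    ∃ f : I × MarkedArray n (AugEntry V E) → T, Measurable f ∧ ∃ η : Fin n → Ω → I,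
      IIDUniform μ η ∧ IndepFun (fun ω i => η i ω) G μ ∧
      ∀ i, ∀ᵐ ω ∂μ, Y ω i = f (η i ω, augmentedCanonicalForm C i i (G ω)) := by
  obtain ⟨t₀⟩ := id ‹Nonempty T›
  -- Vertex features become the diagonal of a symmetric array, constant elsewhere, so that the
  -- function found for arrays applies at the pairs `(i, i)`.
  let D : (Fin n → T) → Fin n → Fin n → T := fun y i j => if i = j then y i else t₀
  have hD : Measurable D := by
    refine measurable_pi_iff.2 fun i => measurable_pi_iff.2 fun j => ?_
    by_cases h : i = j
    · simp only [D, if_pos h]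
      fun_prop
    · simp only [D, if_neg h]
      fun_prop
  have hDsymm : ∀ ω i j, D (Y ω) i j = D (Y ω) j i := fun ω i j => by
    by_cases h : i = j
    · rw [h]
    · simp only [D, if_neg h, if_neg (Ne.symm h)]
  have hDinv : InvariantLaw μ G (fun ω => D (Y ω)) := fun π => by
    have hp : Measurable fun q : FeatureGraph n V E × (Fin n → T) => (q.1, D q.2) :=
      measurable_fst.prodMk (hD.comp measurable_snd)
    have hGπ : Measurable fun ω => (G ω).relabel π :=
      (FeatureGraph.measurable_relabel π).comp hG
    have hYπ : Measurable fun ω i => Y ω (π i) := by fun_prop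
    have e : ∀ y, D (fun i => y (π i)) = relabelArray π (D y) := fun y => by
      funext i j
      simp [D, relabelArray]
    have := congrArg (Measure.map fun q : FeatureGraph n V E × (Fin n → T) => (q.1, D q.2))
      (hinv π)
    rw [Measure.map_map hp (hGπ.prodMk hYπ), Measure.map_map hp (hG.prodMk hY)] at this
    simpa only [Function.comp_def, e] using this
  obtain ⟨f, hf, hlaw, -⟩ := hDinv.exists_outsourcing_function hG (hD.comp hY) hDsymm C
  obtain ⟨η, hiid, hηind, hrep⟩ := hci.exists_noise hG (fun p => by fun_prop) hU hUlaw hind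
    (fun i g u => f (u, augmentedCanonicalForm C i i g))
    (fun i => hf.comp (measurable_snd.prodMk
      ((measurable_augmentedCanonicalForm C _ _).comp measurable_fst)))
    (fun i => by simpa [D] using hlaw i i)
  exact ⟨f, hf, η, hiid, hηind, hrep⟩

end Main

/-! ### The characterization -/

theorem theorem16 {Ω 𝒳 𝒴 : Type*} [MeasurableSpace Ω]
    [MeasurableSpace 𝒳] [StandardBorelSpace 𝒳]
    [MeasurableSpace 𝒴] [StandardBorelSpace 𝒴] [Nonempty 𝒴]
    (μ : Measure Ω) [IsProbabilityMeasure μ] (n : ℕ)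
    (X : Ω → Fin n → 𝒳) (Xb : Ω → Fin n → Fin n → 𝒳)
    (Y : Ω → Fin n → 𝒴) (Yb : Ω → Fin n → Fin n → 𝒴)
    (hX : Measurable X) (hXb : Measurable Xb) (hY : Measurable Y) (hYb : Measurable Yb)
    (hXb_symm : ∀ ω i j, Xb ω i j = Xb ω j i)
    (hYb_symm : ∀ ω i j, Yb ω i j = Yb ω j i)
    -- the probability space is rich enough to support outsourced noise
    (hrich : ∃ U : Ω → unitInterval, Measurable U ∧ μ.map U = volume ∧
      IndepFun U (fun ω => (X ω, Xb ω, Y ω, Yb ω)) μ)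
    (hexch : JointlyExchangeable μ (fun ω => (X ω, Xb ω)))
    (hedge : MutuallyCondIndepGiven μ (fun ω => (X ω, Xb ω))
      (fun (p : LowerIdx n) ω => Yb ω p.1.1 p.1.2))
    (hvertex : ∀ i : Fin n, CondIndepGiven μ (fun ω => (X ω, Xb ω, Yb ω))
      (fun ω => Y ω i) (fun ω (k : {k : Fin n // k ≠ i}) => Y ω k))
    -- arbitrary canonicalization procedures
    (Ce : Canonicalization n (AugEntry 𝒳 𝒳))
    (Cv : Canonicalization n (AugEntry 𝒳 (𝒳 × 𝒴))) :
    CondEquivariant μ (fun ω => (X ω, Xb ω)) (fun ω => (Y ω, Yb ω)) ↔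
      ∃ (fe : unitInterval × 𝒳 × Sym2 𝒳 × MarkedArray n (AugEntry 𝒳 𝒳) → 𝒴)
        (fv : unitInterval × 𝒳 × 𝒳 × 𝒴 × MarkedArray n (AugEntry 𝒳 (𝒳 × 𝒴)) → 𝒴),
        Measurable fe ∧ Measurable fv ∧
        ∃ (η : Fin n → Fin n → Ω → unitInterval) (ηv : Fin n → Ω → unitInterval),
          (∀ i j, η i j = η j i) ∧
          IIDUniform μ (fun p : LowerIdx n => η p.1.1 p.1.2) ∧
          IndepFun (fun ω (p : LowerIdx n) => η p.1.1 p.1.2 ω) (fun ω => (X ω, Xb ω)) μ ∧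
          IIDUniform μ ηv ∧
          IndepFun (fun ω i => ηv i ω) (fun ω => (X ω, Xb ω, Yb ω)) μ ∧
          (∀ i j, ∀ᵐ ω ∂μ, Yb ω i j =
            fe (η i j ω, Xb ω i j, s(X ω i, X ω j),
              augmentedCanonicalForm Ce i j (X ω, Xb ω))) ∧
          (∀ i, ∀ᵐ ω ∂μ, Y ω i =
            fv (ηv i ω, X ω i, Xb ω i i, Yb ω i i,
              augmentedCanonicalForm Cv i i (X ω, stack (Xb ω) (Yb ω)))) := by
  have hG : Measurable fun ω => (X ω, Xb ω) := hX.prodMk hXb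
  have hH : Measurable fun ω => (Y ω, Yb ω) := hY.prodMk hYb
  have hS : Measurable fun ω => ((X ω, stack (Xb ω) (Yb ω)) : FeatureGraph n 𝒳 (𝒳 × 𝒴)) :=
    hX.prodMk (measurable_stack.comp (hXb.prodMk hYb))
  let φ : (Fin n → 𝒳) × (Fin n → Fin n → 𝒳) × (Fin n → Fin n → 𝒴) →
    FeatureGraph n 𝒳 (𝒳 × 𝒴) := fun q => (q.1, stack q.2.1 q.2.2)
  let ψ : FeatureGraph n 𝒳 (𝒳 × 𝒴) →
    (Fin n → 𝒳) × (Fin n → Fin n → 𝒳) × (Fin n → Fin n → 𝒴) :=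
    fun g => (g.1, fun k l => (g.2 k l).1, fun k l => (g.2 k l).2)
  have hφ : Measurable φ := measurable_fst.prodMk (measurable_stack.comp measurable_snd)
  have hψ : Measurable ψ := by fun_prop
  rw [condEquivariant_iff hG hH hexch]
  constructor
  · intro h
    obtain ⟨U, hU, hUlaw, hUind⟩ := hrich
    have hGπ : ∀ π : Equiv.Perm (Fin n),
        Measurable fun ω => (FeatureGraph.relabel π (X ω, Xb ω)) := fun π =>
      (FeatureGraph.measurable_relabel π).comp hG
    have hHπ : ∀ π : Equiv.Perm (Fin n),
        Measurable fun ω => (FeatureGraph.relabel π (Y ω, Yb ω)) := fun π =>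
      (FeatureGraph.measurable_relabel π).comp hH
    have hedgeinv : InvariantLaw μ (fun ω => (X ω, Xb ω)) Yb := fun π => by
      have hp : Measurable fun q : FeatureGraph n 𝒳 𝒳 × FeatureGraph n 𝒴 𝒴 => (q.1, q.2.2) := by
        fun_prop
      have := congrArg (Measure.map fun q : FeatureGraph n 𝒳 𝒳 × FeatureGraph n 𝒴 𝒴 =>
        (q.1, q.2.2)) (h π)
      rw [Measure.map_map hp ((hGπ π).prodMk (hHπ π)), Measure.map_map hp (hG.prodMk hH)] at this
      exact this
    have hvertexinv : ∀ π : Equiv.Perm (Fin n),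
        μ.map (fun ω => ((FeatureGraph.relabel π (X ω, stack (Xb ω) (Yb ω))),
          fun i => Y ω (π i))) = μ.map (fun ω => ((X ω, stack (Xb ω) (Yb ω)), Y ω)) := fun π => by
      have hp : Measurable fun q : FeatureGraph n 𝒳 𝒳 × FeatureGraph n 𝒴 𝒴 =>
          ((q.1.1, stack q.1.2 q.2.2), q.2.1) :=
        Measurable.prodMk (Measurable.prodMk (by fun_prop) (measurable_stack.comp
          ((measurable_snd.comp measurable_fst).prodMk (measurable_snd.comp measurable_snd))))
          (by fun_prop)
      have := congrArg (Measure.map fun q : FeatureGraph n 𝒳 𝒳 × FeatureGraph n 𝒴 𝒴 =>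
        ((q.1.1, stack q.1.2 q.2.2), q.2.1)) (h π)
      rw [Measure.map_map hp ((hGπ π).prodMk (hHπ π)), Measure.map_map hp (hG.prodMk hH)] at this
      exact this
    have hUedge : IndepFun U (fun ω => ((X ω, Xb ω), Yb ω)) μ :=
      hUind.comp (φ := id) (ψ := fun q : (Fin n → 𝒳) × (Fin n → Fin n → 𝒳) × (Fin n → 𝒴) ×
        (Fin n → Fin n → 𝒴) => ((q.1, q.2.1), q.2.2.2)) measurable_id (by fun_prop)
    have hUvertex : IndepFun U (fun ω => ((X ω, stack (Xb ω) (Yb ω)), Y ω)) μ :=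
      hUind.comp (φ := id) (ψ := fun q : (Fin n → 𝒳) × (Fin n → Fin n → 𝒳) × (Fin n → 𝒴) ×
        (Fin n → Fin n → 𝒴) => (φ (q.1, q.2.1, q.2.2.2), q.2.2.1)) measurable_id
        ((hφ.comp (by fun_prop)).prodMk (by fun_prop))
    -- The same `U` generates the edge noise here and the vertex noise below: no independence
    -- between the two families is claimed, and the converse needs none.
    obtain ⟨fe, hfe, η, hηsymm, hηiid, hηind, hYbrep⟩ :=
      hedgeinv.exists_edge_representation hG hYb hYb_symm hU hUlaw hUedge hedge Ce
    -- Stacking is invertible, so conditioning on the stacked graph is conditioning on the triple.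
    have hci : MutuallyCondIndepGiven μ (fun ω => φ (X ω, Xb ω, Yb ω)) (fun i ω => Y ω i) :=
      (mutuallyCondIndepGiven_of_condIndepGiven_rest (hX.prodMk (hXb.prodMk hYb))
        hvertex).of_comp hφ hψ fun _ => rfl
    obtain ⟨fv, hfv, ηv, hηviid, hηvind, hYrep⟩ :=
      exists_vertex_representation hS hY hvertexinv hU hUlaw hUvertex hci Cv
    -- The canonical form and the noise suffice; the local features are ignored as arguments.
    exact ⟨fun q => fe (q.1, q.2.2.2), fun q => fv (q.1, q.2.2.2.2), by fun_prop, by fun_prop,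
      η, ηv, hηsymm, hηiid, hηind, hηviid, hηvind.comp measurable_id hψ, hYbrep, hYrep⟩
  · rintro ⟨fe, fv, hfe, hfv, η, ηv, hηsymm, hηiid, hηind, hηviid, hηvind, hYbrep, hYrep⟩ π
    have hedgeinv : InvariantLaw μ (fun ω => (X ω, Xb ω)) Yb :=
      invariantLaw_of_edge_representation hG hexch Ce hfe hηsymm hηiid hηind hYbrep
    have hstackinv : ∀ π : Equiv.Perm (Fin n),
        μ.map (fun ω => (FeatureGraph.relabel π (X ω, stack (Xb ω) (Yb ω)))) =
          μ.map (fun ω => ((X ω, stack (Xb ω) (Yb ω)) : FeatureGraph n 𝒳 (𝒳 × 𝒴))) := fun π => by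
      have hp : Measurable fun q : FeatureGraph n 𝒳 𝒳 × (Fin n → Fin n → 𝒴) =>
          ((q.1.1, stack q.1.2 q.2) : FeatureGraph n 𝒳 (𝒳 × 𝒴)) :=
        hφ.comp (by fun_prop : Measurable fun q : FeatureGraph n 𝒳 𝒳 × (Fin n → Fin n → 𝒴) =>
          (q.1.1, q.1.2, q.2))
      have hGπ : Measurable fun ω => (FeatureGraph.relabel π (X ω, Xb ω)) :=
        (FeatureGraph.measurable_relabel π).comp hG
      have hYbπ : Measurable fun ω => relabelArray π (Yb ω) := (measurable_relabelArray π).comp hYb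
      have := congrArg (Measure.map fun q : FeatureGraph n 𝒳 𝒳 × (Fin n → Fin n → 𝒴) =>
        ((q.1.1, stack q.1.2 q.2) : FeatureGraph n 𝒳 (𝒳 × 𝒴))) (hedgeinv π)
      rw [Measure.map_map hp (hGπ.prodMk hYbπ), Measure.map_map hp (hG.prodMk hYb)] at this
      exact this
    -- Over the stacked graph, the diagonal edge feature is the pair `(Xb ω i i, Yb ω i i)`, which
    -- supplies two arguments of `fv`. Unstacking the resulting law gives the claim.
    have hjoint := map_relabel_eq_of_vertex_representation (Y := Y)
      (f := fun q : I × 𝒳 × (𝒳 × 𝒴) × MarkedArray n (AugEntry 𝒳 (𝒳 × 𝒴)) =>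
        fv (q.1, q.2.1, q.2.2.1.1, q.2.2.1.2, q.2.2.2))
      hS hstackinv Cv (by fun_prop) hηviid (hηvind.comp measurable_id hφ) hYrep π
    have hp : Measurable fun q : FeatureGraph n 𝒳 (𝒳 × 𝒴) × (Fin n → 𝒴) =>
        (((q.1.1, fun k l => (q.1.2 k l).1), (q.2, fun k l => (q.1.2 k l).2)) :
          FeatureGraph n 𝒳 𝒳 × FeatureGraph n 𝒴 𝒴) := by fun_prop
    have hSπ : Measurable fun ω => (FeatureGraph.relabel π (X ω, stack (Xb ω) (Yb ω))) :=
      (FeatureGraph.measurable_relabel π).comp hS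
    have hYπ : Measurable fun ω i => Y ω (π i) := by fun_prop
    have := congrArg (Measure.map fun q : FeatureGraph n 𝒳 (𝒳 × 𝒴) × (Fin n → 𝒴) =>
      (((q.1.1, fun k l => (q.1.2 k l).1), (q.2, fun k l => (q.1.2 k l).2)) :
        FeatureGraph n 𝒳 𝒳 × FeatureGraph n 𝒴 𝒴)) hjoint
    rw [Measure.map_map hp (hSπ.prodMk hYπ), Measure.map_map hp (hS.prodMk hY)] at this
    exact this
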